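/- Let $X$ be a real Banach space. A sequence $(x_n)_{n\ge 0}$ in $X$ is called almost overcomplete if, for every subsequence $(x_{n_k})_{k\ge 0}$ of it, the closed linear span $\overline{\operatorname{span}}\{x_{n_k} : k\ge 0\}$ has finite codimension in $X$. Then every bounded almost overcomplete sequence $(x_n)_{n\ge 0}$ in $X$ is relatively compact; that is, the norm closure of $\{x_n : n\ge 0\}$ is compact in the norm topology of $X$. -/

import Mathlib

/-- A sequence `x` in a real normed space `X` is *almost overcomplete* if the closed linear span
of each of its subsequences has finite codimension in `X`, that is, the quotient of `X` by this
span is finite-dimensional. -/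
def AlmostOvercomplete {X : Type*} [NormedAddCommGroup X] [NormedSpace ℝ X] (x : ℕ → X) : Prop :=
  ∀ φ : ℕ → ℕ, StrictMono φ →
    FiniteDimensional ℝ (X ⧸ (Submodule.span ℝ (Set.range (x ∘ φ))).topologicalClosure)

open Filter Topology

/-! If the range is not totally bounded, `x` fails to be Cauchy along some free ultrafilter. In the
bidual, Banach-Alaoglu gives a weak-star limit `w` of `J (x n)`, and `J (x n) - w` is weak-star null
but bounded away from zero. Mazur's construction extracts a basic subsequence `v k` of these
differences, with `w` put into every initial span because it need not come from `X`. The odd `v k`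
are then independent modulo the closed span of `w` and the even `v k`. That span contains the images
of the even `x` terms, so the odd `x` terms are independent modulo the closed span of the even ones,
which thus has infinite codimension. -/

/-- **Mazur's lemma** in a dual space: a weak-star null family that is bounded away from zero is
eventually almost orthogonal to any finite-dimensional subspace. -/
theorem eventually_norm_le_mul_norm_add_smul {ι E : Type*} [NormedAddCommGroup E]
    [NormedSpace ℝ E] {U : Filter ι} {y : ι → StrongDual ℝ E}
    (hy : ∀ f, Tendsto (fun i => y i f) U (𝓝 0)) {c : ℝ} (hc : 0 < c)
    (hyc : ∀ᶠ i in U, c ≤ ‖y i‖) (S : Submodule ℝ (StrongDual ℝ E)) [FiniteDimensional ℝ S]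
    {r : ℝ} (hr : 1 < r) :
    ∀ᶠ i in U, ∀ e ∈ S, ∀ t : ℝ, ‖e‖ ≤ r * ‖e + t • y i‖ := by
  have hr0 : 0 < r := by linarith
  have hr1 : r⁻¹ < 1 := inv_lt_one_of_one_lt₀ hr
  have hr2 : 0 < r⁻¹ := inv_pos.2 hr0
  -- One `δ` each for the norming error, the distance to the finite net, and the contribution of `t
  -- • y i`.
  obtain ⟨δ, hδ, hδr⟩ : ∃ δ : ℝ, 0 < δ ∧ r⁻¹ = 1 - 3 * δ := ⟨(1 - r⁻¹) / 3, by linarith, by ring⟩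
  have hnorming : ∀ e : S, ‖e‖ = 1 → ∃ f : E, ‖f‖ < 1 ∧ 1 - δ < ‖(e : StrongDual ℝ E) f‖ := by
    intro e he
    exact (e : StrongDual ℝ E).exists_lt_apply_of_lt_opNorm (r := 1 - δ)
      (by rw [← Submodule.coe_norm, he]; linarith)
  choose! f hf1 hf2 using hnorming
  obtain ⟨T, hT, hcover⟩ := (isCompact_sphere (0 : S) 1).elim_nhds_subcover
    (fun e => Metric.ball e δ) (fun e _ => Metric.ball_mem_nhds e hδ)
  have hsmall : ∀ᶠ i in U, ∀ z ∈ T, ‖y i (f z)‖ < δ * c / 2 := by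
    refine (Filter.eventually_all_finset T).2 fun z _ => ?_
    have := (hy (f z)).norm
    rw [norm_zero] at this
    exact this.eventually_lt_const (by positivity)
  have key : ∀ᶠ i in U, ∀ e : S, ‖e‖ = 1 → ∀ t : ℝ,
      r⁻¹ ≤ ‖(e : StrongDual ℝ E) + t • y i‖ := by
    filter_upwards [hyc, hsmall] with i hi hsi e he t
    -- Small `t`: test against the vector norming a nearby net point. Large `t`: `t • y i` has norm
    -- at least 2, so the triangle inequality suffices.
    rcases le_or_gt (|t| * c) 2 with ht | ht
    · obtain ⟨z, hz, hez⟩ : ∃ z ∈ T, e ∈ Metric.ball z δ := by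
        simpa using hcover (show dist (e : StrongDual ℝ E) 0 = 1 from (dist_zero_right _).trans he)
      have hz1 : ‖z‖ = 1 := (dist_zero_right (z : StrongDual ℝ E)).symm.trans (hT z hz)
      have hfz := (hf1 z hz1).le
      have h1 : ‖(z : StrongDual ℝ E) (f z) - (e : StrongDual ℝ E) (f z)‖ ≤ δ := by
        rw [← sub_apply]
        refine (ContinuousLinearMap.unit_le_opNorm _ _ hfz).trans ?_
        rw [← dist_eq_norm]
        exact (Metric.mem_ball'.1 hez).le
      have h2 : ‖t * y i (f z)‖ ≤ δ := by
        rw [norm_mul, Real.norm_eq_abs t]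
        calc |t| * ‖y i (f z)‖ ≤ |t| * (δ * c / 2) := by gcongr; exact (hsi z hz).le
          _ = δ / 2 * (|t| * c) := by ring
          _ ≤ δ / 2 * 2 := by gcongr
          _ = δ := by ring
      have h3 := ContinuousLinearMap.unit_le_opNorm ((e : StrongDual ℝ E) + t • y i) _ hfz
      have h4 : ‖(z : StrongDual ℝ E) (f z)‖ ≤
          ‖(e : StrongDual ℝ E) (f z) + t * y i (f z)‖ +
          ‖(z : StrongDual ℝ E) (f z) - (e : StrongDual ℝ E) (f z)‖ + ‖t * y i (f z)‖ := by
        refine le_trans (le_of_eq ?_) ((norm_sub_le _ _).trans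
          (add_le_add_left (norm_add_le _ _) _))
        congr 1
        ring
      have h5 := hf2 z hz1
      simp only [add_apply, smul_apply, smul_eq_mul] at h3
      linarith
    · have h1 : 2 ≤ ‖t • y i‖ := by
        rw [norm_smul, Real.norm_eq_abs]
        exact ht.le.trans (by gcongr)
      have h2 : ‖t • y i‖ ≤ ‖(e : StrongDual ℝ E) + t • y i‖ + ‖(e : StrongDual ℝ E)‖ := by
        simpa using norm_sub_le ((e : StrongDual ℝ E) + t • y i) (e : StrongDual ℝ E)
      rw [← Submodule.coe_norm, he] at h2
      linarith
  filter_upwards [key] with i hi e he t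
  rcases eq_or_ne e 0 with rfl | he0
  · simpa using by positivity
  have hn : 0 < ‖e‖ := norm_pos_iff.2 he0
  have h := hi (‖e‖⁻¹ • ⟨e, he⟩) (by simp [norm_smul, hn.ne']) (‖e‖⁻¹ * t)
  have heq : ((‖e‖⁻¹ • (⟨e, he⟩ : S) : S) : StrongDual ℝ E) + (‖e‖⁻¹ * t) • y i
      = ‖e‖⁻¹ • (e + t • y i) := by
    rw [smul_add, smul_smul]; rfl
  rw [heq, norm_smul, norm_inv, norm_norm, inv_mul_eq_div, inv_eq_one_div,
    div_le_div_iff₀ hr0 hn] at h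
  linarith

/-- Selection of a basic subsequence by iterating Mazur's lemma, starting from a given vector. -/
theorem exists_strictMono_norm_le_two_mul {F : Type*} [NormedAddCommGroup F] [NormedSpace ℝ F]
    (y : ℕ → F) (w : F) {U : Filter ℕ} [NeBot U] (hU : U ≤ atTop)
    {P : ℕ → Prop} (hP : ∀ᶠ i in U, P i)
    (h : ∀ S : Submodule ℝ F, FiniteDimensional ℝ S → ∀ r : ℝ, 1 < r →
      ∀ᶠ i in U, ∀ e ∈ S, ∀ t : ℝ, ‖e‖ ≤ r * ‖e + t • y i‖) :
    ∃ φ : ℕ → ℕ, StrictMono φ ∧ (∀ n, P (φ n)) ∧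
      ∀ j, ∀ e ∈ Submodule.span ℝ (insert w ((y ∘ φ) '' Set.Iic j)),
      ∀ u ∈ Submodule.span ℝ ((y ∘ φ) '' Set.Ioi j), ‖e‖ ≤ 2 * ‖e + u‖ := by
  -- `C` increases from 1 and stays below 2, so the Mazur constants `C (m + 1) / C m` telescope to a
  -- bound of 2.
  set C : ℕ → ℝ := fun n => 2 - 1 / ((n : ℝ) + 1) with hC
  have hCmono : StrictMono C := fun m n hmn => by
    have := Nat.one_div_lt_one_div (α := ℝ) hmn
    simp only [hC]; linarith
  have hC1 : ∀ n, 1 ≤ C n := fun n => by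
    refine le_trans ?_ (hCmono.monotone n.zero_le)
    simp only [hC]; norm_num
  have hC2 : ∀ n, C n ≤ 2 := fun n => by
    have := Nat.one_div_pos_of_nat (α := ℝ) (n := n)
    simp only [hC]; linarith
  -- Using every term up to `n`, not just the selected ones, makes the selection condition a
  -- relation between two indices.
  let E : ℕ → Submodule ℝ F := fun n => Submodule.span ℝ (insert w (y '' Set.Iic n))
  have hE : ∀ n, FiniteDimensional ℝ (E n) := fun n =>
    FiniteDimensional.span_of_finite ℝ (((Set.finite_Iic n).image y).insert w)
  obtain ⟨φ, hφP, hφ⟩ := exists_seq_of_forall_finset_exists P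
    (fun m n => m < n ∧ ∀ e ∈ E m, ∀ t : ℝ, C m * ‖e‖ ≤ C (m + 1) * ‖e + t • y n‖) (by
      intro s _
      have hev : ∀ᶠ n in U, ∀ m ∈ s, m < n ∧ ∀ e ∈ E m, ∀ t : ℝ,
          C m * ‖e‖ ≤ C (m + 1) * ‖e + t • y n‖ := by
        refine (Filter.eventually_all_finset s).2 fun m _ => ?_
        have hm : 0 < C m := one_pos.trans_le (hC1 m)
        filter_upwards [hU (eventually_gt_atTop m), h (E m) (hE m) (C (m + 1) / C m)
          ((one_lt_div hm).2 (hCmono m.lt_succ_self))] with n hn hn'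
        refine ⟨hn, fun e he t => ?_⟩
        have := hn' e he t
        rw [div_mul_eq_mul_div, le_div_iff₀ hm] at this
        linarith
      exact (hP.and hev).exists)
  have hmono : StrictMono φ := fun m n hmn => (hφ m n hmn).1
  have hsub : ∀ k, Submodule.span ℝ (insert w ((y ∘ φ) '' Set.Iic k)) ≤ E (φ k) := fun k => by
    refine Submodule.span_mono (Set.insert_subset_insert ?_)
    rintro _ ⟨i, hi, rfl⟩
    exact ⟨φ i, hmono.monotone hi, rfl⟩
  refine ⟨φ, hmono, hφP, fun j e he u hu => ?_⟩
  have key : ∀ k, j ≤ k → ∀ u ∈ Submodule.span ℝ ((y ∘ φ) '' Set.Ioc j k),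
      C (φ j) * ‖e‖ ≤ C (φ k) * ‖e + u‖ := by
    intro k hk
    induction k, hk using Nat.le_induction with
    | base => simp
    | succ k hk ih =>
      intro u hu
      rw [show Set.Ioc j (k + 1) = insert (k + 1) (Set.Ioc j k) by ext; simp; omega,
        Set.image_insert_eq, Submodule.mem_span_insert] at hu
      obtain ⟨a, v, hv, rfl⟩ := hu
      have hmem : e + v ∈ E (φ k) := hsub k <| add_mem
        (Submodule.span_mono (Set.insert_subset_insert (Set.image_mono (Set.Iic_subset_Iic.2 hk))) he)
        (Submodule.span_mono ((Set.image_mono Set.Ioc_subset_Iic_self).trans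
          (Set.subset_insert _ _)) hv)
      calc C (φ j) * ‖e‖ ≤ C (φ k) * ‖e + v‖ := ih v hv
        _ ≤ C (φ k + 1) * ‖e + v + a • y (φ (k + 1))‖ := (hφ k (k + 1) k.lt_succ_self).2 _ hmem a
        _ ≤ C (φ (k + 1)) * ‖e + v + a • y (φ (k + 1))‖ := by
          gcongr
          exact hCmono.monotone (hmono k.lt_succ_self)
        _ = _ := by simp only [Function.comp_apply]; congr 2; abel
  obtain ⟨k, hk, huk⟩ : ∃ k, j ≤ k ∧ u ∈ Submodule.span ℝ ((y ∘ φ) '' Set.Ioc j k) := by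
    induction hu using Submodule.span_induction with
    | mem x hx =>
      obtain ⟨i, hi, rfl⟩ := hx
      exact ⟨i, le_of_lt hi, Submodule.subset_span ⟨i, ⟨hi, le_rfl⟩, rfl⟩⟩
    | zero => exact ⟨j, le_rfl, zero_mem _⟩
    | add a b _ _ ha hb =>
      obtain ⟨k, hk, ha⟩ := ha
      obtain ⟨l, hl, hb⟩ := hb
      exact ⟨max k l, hk.trans (le_max_left _ _), add_mem
        (Submodule.span_mono (Set.image_mono (Set.Ioc_subset_Ioc_right (le_max_left _ _))) ha)
        (Submodule.span_mono (Set.image_mono (Set.Ioc_subset_Ioc_right (le_max_right _ _))) hb)⟩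
    | smul a b _ hb =>
      obtain ⟨k, hk, hb⟩ := hb
      exact ⟨k, hk, Submodule.smul_mem _ _ hb⟩
  calc ‖e‖ ≤ C (φ j) * ‖e‖ := le_mul_of_one_le_left (norm_nonneg _) (hC1 _)
    _ ≤ C (φ k) * ‖e + u‖ := key k hk u huk
    _ ≤ 2 * ‖e + u‖ := by gcongr; exact hC2 _

/-- The terms of a basic sequence, apart from the initial ones, are not in the closed span of the
others. -/
theorem notMem_topologicalClosure_span_of_norm_le {F : Type*} [NormedAddCommGroup F]
    [NormedSpace ℝ F] {v : ℕ → F} {w : F}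
    (h : ∀ j, ∀ e ∈ Submodule.span ℝ (insert w (v '' Set.Iic j)),
      ∀ u ∈ Submodule.span ℝ (v '' Set.Ioi j), ‖e‖ ≤ 2 * ‖e + u‖)
    {i : ℕ} (hv : v (i + 1) ≠ 0) :
    v (i + 1) ∉ (Submodule.span ℝ (insert w (v '' {i + 1}ᶜ))).topologicalClosure := by
  intro hmem
  have hpos : 0 < ‖v (i + 1)‖ := norm_pos_iff.2 hv
  -- With `z = e + u` split at `i + 1`, both `e` and `v (i + 1) - e` have norm at most twice the
  -- distance to `z`; hence the factor 4.
  obtain ⟨z, hz, hdist⟩ := Metric.mem_closure_iff.1 hmem (‖v (i + 1)‖ / 4) (by positivity)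
  have hset : insert w (v '' {i + 1}ᶜ) = insert w (v '' Set.Iic i) ∪ v '' Set.Ioi (i + 1) := by
    rw [Set.insert_union, ← Set.image_union]
    congr 2
    ext; simp; omega
  replace hz : z ∈ Submodule.span ℝ _ := hz
  rw [hset, Submodule.span_union, Submodule.mem_sup] at hz
  obtain ⟨e, he, u, hu, rfl⟩ := hz
  have h1 := h i (-e) (neg_mem he) (v (i + 1) - u) (sub_mem
    (Submodule.subset_span ⟨i + 1, i.lt_succ_self, rfl⟩)
    (neg_mem_iff.1 (neg_mem (Submodule.span_mono
      (Set.image_mono (Set.Ioi_subset_Ioi i.le_succ)) hu))))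
  have h2 := h (i + 1) (v (i + 1) - e) (sub_mem
    (Submodule.subset_span (Set.mem_insert_of_mem _ ⟨i + 1, Set.mem_Iic.2 le_rfl, rfl⟩))
    (Submodule.span_mono (Set.insert_subset_insert
      (Set.image_mono (Set.Iic_subset_Iic.2 i.le_succ))) he)) (-u) (neg_mem hu)
  have h3 : ‖v (i + 1)‖ ≤ ‖v (i + 1) - e‖ + ‖-e‖ := by
    rw [norm_neg]
    simpa using norm_add_le (v (i + 1) - e) e
  rw [dist_eq_norm] at hdist
  rw [show -e + (v (i + 1) - u) = v (i + 1) - (e + u) by abel] at h1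
  rw [show v (i + 1) - e + -u = v (i + 1) - (e + u) by abel] at h2
  linarith

/-- A family of vectors none of which lies in the closed span of the others together with `s` is
linearly independent modulo the closed span of `s`. -/
theorem linearIndependent_mkQ_of_notMem {ι F : Type*} [NormedAddCommGroup F] [NormedSpace ℝ F]
    {v : ι → F} {s : Set F}
    (h : ∀ i, v i ∉ (Submodule.span ℝ (s ∪ v '' {i}ᶜ)).topologicalClosure) :
    LinearIndependent ℝ (fun i => (Submodule.span ℝ s).topologicalClosure.mkQ (v i)) := by
  rw [linearIndependent_iff_notMem_span]
  intro i hi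
  rw [← Set.compl_eq_univ_sdiff, ← Function.comp_def, Set.image_comp, Submodule.span_image,
    ← Submodule.mem_comap, Submodule.comap_map_mkQ] at hi
  refine h i (SetLike.le_def.1 (sup_le ?_ ?_) hi)
  · exact Submodule.topologicalClosure_mono (Submodule.span_mono Set.subset_union_left)
  · exact (Submodule.span_mono Set.subset_union_right).trans (Submodule.le_topologicalClosure _)

/-- A bounded family in a normed space converges weak-star along any ultrafilter to an element of
the bidual. -/
theorem exists_tendsto_bidual {ι X : Type*} [NormedAddCommGroup X] [NormedSpace ℝ X]
    (U : Ultrafilter ι) {x : ι → X} (hb : Bornology.IsBounded (Set.range x)) :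
    ∃ w : StrongDual ℝ (StrongDual ℝ X), ∀ f : StrongDual ℝ X,
      Tendsto (fun i => f (x i)) U (𝓝 (w f)) := by
  obtain ⟨R, hR⟩ := hb.exists_norm_le
  let g : ι → WeakDual ℝ (StrongDual ℝ X) := fun i =>
    StrongDual.toWeakDual (NormedSpace.inclusionInDoubleDual ℝ X (x i))
  obtain ⟨w, -, hw⟩ := (WeakDual.isCompact_closedBall (𝕜 := ℝ)
    (0 : StrongDual ℝ (StrongDual ℝ X)) R).ultrafilter_le_nhds (U.map g) (by
      rw [le_principal_iff]
      refine Filter.mem_map.2 (univ_mem' fun i => ?_)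
      simpa [g] using (NormedSpace.double_dual_bound ℝ X (x i)).trans (hR _ ⟨i, rfl⟩))
  refine ⟨WeakDual.toStrongDual w, fun f => ?_⟩
  exact ((WeakDual.eval_continuous f).tendsto w).comp (show Tendsto g U (𝓝 w) from hw)

/-- If `J (x k) - w` is a basic sequence, then the closed span of the even terms of `x` has infinite
codimension. -/
theorem not_finiteDimensional_quotient_span_even {X F : Type*} [NormedAddCommGroup X]
    [NormedSpace ℝ X] [NormedAddCommGroup F] [NormedSpace ℝ F] (J : X →ₗᵢ[ℝ] F) {x : ℕ → X} {w : F}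
    {v : ℕ → F} (hv : ∀ k, v k = J (x k) - w) (hv0 : ∀ k, v k ≠ 0)
    (h : ∀ j, ∀ e ∈ Submodule.span ℝ (insert w (v '' Set.Iic j)),
      ∀ u ∈ Submodule.span ℝ (v '' Set.Ioi j), ‖e‖ ≤ 2 * ‖e + u‖) :
    ¬ FiniteDimensional ℝ
      (X ⧸ (Submodule.span ℝ (Set.range fun k => x (2 * k))).topologicalClosure) := by
  intro hfin
  let s : Set F := insert w (v '' Set.range (2 * ·))
  set W := (Submodule.span ℝ (Set.range fun k => x (2 * k))).topologicalClosure
  let V := (Submodule.span ℝ s).topologicalClosure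
  have hind : LinearIndependent ℝ (fun k => V.mkQ (v (2 * k + 1))) := by
    refine linearIndependent_mkQ_of_notMem fun k hk => ?_
    refine notMem_topologicalClosure_span_of_norm_le h (i := 2 * k) (hv0 _) ?_
    refine Submodule.topologicalClosure_mono (Submodule.span_mono ?_) hk
    rintro _ ((rfl | ⟨_, ⟨l, rfl⟩, rfl⟩) | ⟨l, hl, rfl⟩)
    · exact Set.mem_insert _ _
    · exact Set.mem_insert_of_mem _ ⟨2 * l, by simp; omega, rfl⟩
    · exact Set.mem_insert_of_mem _ ⟨2 * l + 1, by simpa using hl, rfl⟩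
  have hwV : w ∈ V :=
    Submodule.le_topologicalClosure _ (Submodule.subset_span (Set.mem_insert _ _))
  have hWV : W ≤ V.comap J.toLinearMap := by
    refine Submodule.topologicalClosure_minimal _ (Submodule.span_le.2 ?_)
      ((Submodule.isClosed_topologicalClosure _).preimage J.continuous)
    rintro _ ⟨k, rfl⟩
    have hk : v (2 * k) ∈ V := Submodule.le_topologicalClosure _
      (Submodule.subset_span (Set.mem_insert_of_mem _ ⟨2 * k, ⟨k, rfl⟩, rfl⟩))
    simpa [hv] using add_mem hk hwV
  have hindX : LinearIndependent ℝ (fun k => W.mkQ (x (2 * k + 1))) := by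
    -- Since `w ∈ V`, the images of `x k` and `v k` agree modulo `V`.
    refine LinearIndependent.of_comp (W.mapQ V J.toLinearMap hWV) ?_
    convert hind using 2 with k
    refine (Submodule.Quotient.eq V).2 ?_
    simpa [hv] using hwV
  have := hindX.finite_of_isNoetherian
  exact not_finite ℕ

/-- A family whose isometric image converges is Cauchy. -/
theorem LinearIsometry.cauchy_map_of_eventually_norm_sub_lt {ι X F : Type*} [NormedAddCommGroup X]
    [NormedSpace ℝ X] [NormedAddCommGroup F] [NormedSpace ℝ F] (J : X →ₗᵢ[ℝ] F) {l : Filter ι}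
    [NeBot l] {x : ι → X} (w : F) (h : ∀ ε > 0, ∀ᶠ n in l, ‖J (x n) - w‖ < ε) :
    Cauchy (map x l) := by
  have hlim : Tendsto (fun n => J (x n)) l (𝓝 w) :=
    Metric.tendsto_nhds.2 fun ε hε => by simpa only [dist_eq_norm] using h ε hε
  rw [← J.isometry.isUniformInducing.cauchy_map_iff, Filter.map_map]
  exact hlim.cauchy_map

/-- If `J ∘ x - w` is bounded away from zero and satisfies the conclusion of Mazur's lemma, then some
subsequence of `x` has a closed span of infinite codimension. -/
theorem exists_strictMono_not_finiteDimensional_quotient {X F : Type*} [NormedAddCommGroup X]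
    [NormedSpace ℝ X] [NormedAddCommGroup F] [NormedSpace ℝ F] (J : X →ₗᵢ[ℝ] F) {x : ℕ → X} {w : F}
    {U : Filter ℕ} [NeBot U] (hU : U ≤ atTop) {c : ℝ} (hc : 0 < c)
    (hxc : ∀ᶠ n in U, c ≤ ‖J (x n) - w‖)
    (h : ∀ S : Submodule ℝ F, FiniteDimensional ℝ S → ∀ r : ℝ, 1 < r →
      ∀ᶠ i in U, ∀ e ∈ S, ∀ t : ℝ, ‖e‖ ≤ r * ‖e + t • (J (x i) - w)‖) :
    ∃ φ : ℕ → ℕ, StrictMono φ ∧ ¬ FiniteDimensional ℝ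
      (X ⧸ (Submodule.span ℝ (Set.range (x ∘ φ))).topologicalClosure) := by
  obtain ⟨φ, hφ, hφc, hbasic⟩ :=
    exists_strictMono_norm_le_two_mul (fun n => J (x n) - w) w hU hxc h
  exact ⟨fun k => φ (2 * k), fun k l hkl => hφ (Nat.mul_lt_mul_of_pos_left hkl two_pos),
    not_finiteDimensional_quotient_span_even J (x := x ∘ φ) (fun _ => rfl)
      (fun k => norm_pos_iff.1 (hc.trans_le (hφc k))) hbasic⟩

/-- If `x` is isometric to a sequence in a dual space that is weak-star convergent along an ultrafilter,
but `x` is not Cauchy along it, then some subsequence of `x` has a closed span of infinite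
codimension. -/
theorem exists_strictMono_of_not_cauchy {X E : Type*} [NormedAddCommGroup X] [NormedSpace ℝ X]
    [NormedAddCommGroup E] [NormedSpace ℝ E] (J : X →ₗᵢ[ℝ] StrongDual ℝ E) {x : ℕ → X}
    {w : StrongDual ℝ E} {U : Ultrafilter ℕ} (hU : (U : Filter ℕ) ≤ atTop)
    (hw : ∀ f : E, Tendsto (fun n => J (x n) f) U (𝓝 (w f)))
    (hnot : ¬ Cauchy (map x (U : Filter ℕ))) :
    ∃ φ : ℕ → ℕ, StrictMono φ ∧ ¬ FiniteDimensional ℝ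
      (X ⧸ (Submodule.span ℝ (Set.range (x ∘ φ))).topologicalClosure) := by
  have hy : ∀ f, Tendsto (fun n => (J (x n) - w) f) U (𝓝 0) := fun f => by
    simpa using (hw f).sub_const (w f)
  obtain ⟨c, hc, hyc⟩ : ∃ c > 0, ∀ᶠ n in U, c ≤ ‖J (x n) - w‖ := by
    by_contra! hcon
    exact hnot (J.cauchy_map_of_eventually_norm_sub_lt w hcon)
  exact exists_strictMono_not_finiteDimensional_quotient J hU hc hyc
    fun S _ r hr => eventually_norm_le_mul_norm_add_smul hy hc hyc S hr

theorem mainTheorem12 {X : Type*} [NormedAddCommGroup X] [NormedSpace ℝ X] [CompleteSpace X]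
    (x : ℕ → X) (hx : AlmostOvercomplete x) (hb : Bornology.IsBounded (Set.range x)) :
    IsCompact (closure (Set.range x)) := by
  refine TotallyBounded.isCompact_of_isClosed (TotallyBounded.closure ?_) isClosed_closure
  rw [totallyBounded_iff_ultrafilter]
  intro V hV
  by_contra hnot
  have hVx : x '' Set.univ ∈ V := by rw [Set.image_univ]; exact le_principal_iff.1 hV
  set U : Ultrafilter ℕ := Ultrafilter.ofComapInfPrincipal hVx
  have hUV : U.map x = V := Ultrafilter.ofComapInfPrincipal_eq_of_map hVx
  -- A principal `U` would have a principal, hence Cauchy, image.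
  have hU : (U : Filter ℕ) ≤ atTop := by
    rw [← Nat.cofinite_eq_atTop]
    rcases U.le_cofinite_or_eq_pure with h | ⟨a, ha⟩
    · exact h
    · refine absurd ?_ hnot
      rw [← hUV, ha, Ultrafilter.map_pure]
      exact cauchy_pure
  obtain ⟨w, hw⟩ := exists_tendsto_bidual U hb
  obtain ⟨φ, hφ, hφx⟩ := exists_strictMono_of_not_cauchy
    (NormedSpace.inclusionInDoubleDualLi ℝ (E := X)) hU hw (by rwa [← hUV] at hnot)
  exact hφx (hx φ hφ)
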